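/- Let $p$ be a prime and let $S$ be a finite $p$-group. A fusion system on $S$ is a category whose objects are the subgroups of $S$ and whose morphisms from $P$ to $Q$ form a set of injective group homomorphisms $P\to Q$ (composed as maps, with the identity maps as identities), such that (1) for all $s\in S$ and $P,Q\le S$ with $s^{-1}Ps\le Q$, the map $P\to Q$, $u\mapsto s^{-1}us$, is a morphism; and (2) if $f:P\to Q$ is a morphism with image $R=f(P)$, then $f:P\to R$ and $f^{-1}:R\to P$ are morphisms. Let $r\ge 0$, let $\varphi_i:P_i\to Q_i$ ($1\le i\le r$) be injective homomorphisms between subgroups of $S$, and let $\mathcal F$ be the fusion system on $S$ generated by $\varphi_1,\dots,\varphi_r$, that is, the smallest fusion system on $S$ in which every $\varphi_i$ is a morphism. Let $T$ be a free group with free generators $t_1,\dots,t_r$, and let $G$ be the quotient of the free product $S*T$ by the relations $t_i^{-1}ut_i=\varphi_i(u)$ for all $i$ and all $u\in P_i$. Then: (a) the canonical homomorphism $S\to G$ is injective, so that $S$ may be regarded as a subgroup of $G$; (b) every finite $p$-subgroup of $G$ is conjugate in $G$ to a subgroup of $S$; (c) $\mathcal F_S(G)=\mathcal F$, where $\mathcal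 F_S(G)$ is the fusion system on $S$ whose morphisms from $P$ to $Q$ are the homomorphisms $f:P\to Q$ for which there is $g\in G$ with $f(u)=g^{-1}ug$ for all $u\in P$; (d) every finite subgroup of $G$ is conjugate in $G$ to a subgroup of $S$; (e) $G$ has a free normal subgroup whose index is finite and divides $|S|!$. -/

import Mathlib

/-- A fusion system on a group `S` (in the intended use, a finite `p`-group): a category whose
objects are the subgroups of `S` and whose morphisms from `P` to `Q` form a set of injective
homomorphisms `P → Q`, with the usual composition, containing all conjugations by elements of `S`
and, with each `f : P → Q`, the isomorphism `f : P → f(P)` and its inverse. -/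
@[ext]
structure FusionSystem (S : Type*) [Group S] where
  /-- The set of morphisms from `P` to `Q`. -/
  Hom : (P Q : Subgroup S) → Set (P →* Q)
  injective_of_mem : ∀ {P Q : Subgroup S} (f : P →* Q), f ∈ Hom P Q → Function.Injective f
  id_mem : ∀ P : Subgroup S, MonoidHom.id P ∈ Hom P P
  comp_mem : ∀ {P Q R : Subgroup S} (f : P →* Q) (g : Q →* R),
    f ∈ Hom P Q → g ∈ Hom Q R → g.comp f ∈ Hom P R
  /-- Every homomorphism `u ↦ s⁻¹ u s` from `P` to `Q`, with `s ∈ S`, is a morphism. -/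
  conj_mem : ∀ {P Q : Subgroup S} (f : P →* Q) (s : S),
    (∀ u : P, (f u : S) = s⁻¹ * (u : S) * s) → f ∈ Hom P Q
  /-- If `f : P → Q` is a morphism and `e : P ≃ R` is `f` regarded as an isomorphism onto its
  image `R = f(P)`, then `e` and its inverse are morphisms. -/
  corestrict_mem : ∀ {P Q R : Subgroup S} (f : P →* Q) (e : P ≃* R), f ∈ Hom P Q →
    (∀ u : P, (e u : S) = (f u : S)) → e.toMonoidHom ∈ Hom P R ∧ e.symm.toMonoidHom ∈ Hom R P

namespace FusionSystem

/-- Inclusion of fusion systems on `S`. -/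
instance {S : Type*} [Group S] : LE (FusionSystem S) :=
  ⟨fun F F' => ∀ P Q : Subgroup S, F.Hom P Q ⊆ F'.Hom P Q⟩

/-- The fusion system generated by a family of injective homomorphisms `φ i : P i → Q i` between
subgroups of `S`: the intersection of all fusion systems containing every `φ i`. -/
def generatedBy {S : Type*} [Group S] {I : Type*} (P Q : I → Subgroup S)
    (φ : (i : I) → P i →* Q i) : FusionSystem S where
  Hom A B := {f | Function.Injective f ∧
    ∀ F : FusionSystem S, (∀ i, φ i ∈ F.Hom (P i) (Q i)) → f ∈ F.Hom A B}
  injective_of_mem _ hf := hf.1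
  id_mem A := ⟨fun _ _ h => h, fun F _ => F.id_mem A⟩
  comp_mem f g hf hg :=
    ⟨hg.1.comp hf.1, fun F hF => F.comp_mem f g (hf.2 F hF) (hg.2 F hF)⟩
  conj_mem f s h := by
    refine ⟨fun u v huv => ?_, fun F _ => F.conj_mem f s h⟩
    have h1 := h u
    rw [huv, h v] at h1
    exact Subtype.ext (mul_left_cancel (mul_right_cancel h1)).symm
  corestrict_mem f e hf h :=
    ⟨⟨e.injective, fun F hF => (F.corestrict_mem f e (hf.2 F hF) h).1⟩,
      ⟨e.symm.injective, fun F hF => (F.corestrict_mem f e (hf.2 F hF) h).2⟩⟩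

/-- `generatedBy P Q φ` is the smallest fusion system containing every `φ i`. -/
theorem generatedBy_isLeast {S : Type*} [Group S] {I : Type*} (P Q : I → Subgroup S)
    (φ : (i : I) → P i →* Q i) (hφ : ∀ i, Function.Injective (φ i)) :
    (∀ i, φ i ∈ (generatedBy P Q φ).Hom (P i) (Q i)) ∧
      ∀ F : FusionSystem S, (∀ i, φ i ∈ F.Hom (P i) (Q i)) → generatedBy P Q φ ≤ F :=
  ⟨fun i => ⟨hφ i, fun _ hF => hF i⟩, fun F hF _ _ _ hf => hf.2 F hF⟩

/-- The fusion system `F_S(G)` on `S`, where `S` is identified with a subgroup of `G` through the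
injective homomorphism `ι`: the morphisms from `P` to `Q` are the homomorphisms `f : P → Q` that
are equal to `u ↦ g⁻¹ u g` for some `g ∈ G`. -/
def ofGroup {S G : Type*} [Group S] [Group G] (ι : S →* G) (hι : Function.Injective ι) :
    FusionSystem S where
  Hom P Q := {f | ∃ g : G, ∀ u : P, ι (f u : S) = g⁻¹ * ι (u : S) * g}
  injective_of_mem := by
    rintro P Q f ⟨g, hg⟩ u v huv
    have h1 := hg u
    rw [huv, hg v] at h1
    exact Subtype.ext (hι (mul_left_cancel (mul_right_cancel h1)).symm)
  id_mem P := ⟨1, fun u => by simp⟩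
  comp_mem := by
    rintro P Q R f k ⟨g, hg⟩ ⟨g', hg'⟩
    refine ⟨g * g', fun u => ?_⟩
    rw [MonoidHom.comp_apply, hg', hg]
    group
  conj_mem f s h := ⟨ι s, fun u => by simp [h u]⟩
  corestrict_mem := by
    rintro P Q R f e ⟨g, hg⟩ h
    have he : ∀ u : P, ι (e u : S) = g⁻¹ * ι (u : S) * g := fun u => by rw [h u, hg u]
    refine ⟨⟨g, he⟩, ⟨g⁻¹, fun v => ?_⟩⟩
    have h1 := he (e.symm v)
    rw [e.apply_symm_apply] at h1
    change ι ((e.symm v : P) : S) = _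
    rw [h1]
    group

end FusionSystem

/-- The elements `t_i⁻¹ u t_i φ_i(u)⁻¹`, for `i` an index and `u ∈ P_i`, of the free product
`S * T`, where `T` is the free group on the letters `t_i`. -/
def multipleHNNRelators {S : Type*} [Group S] {r : ℕ} (P Q : Fin r → Subgroup S)
    (φ : (i : Fin r) → P i →* Q i) : Set (Monoid.Coprod S (FreeGroup (Fin r))) :=
  {w | ∃ (i : Fin r) (u : P i), w =
    (Monoid.Coprod.inr (FreeGroup.of i))⁻¹ * Monoid.Coprod.inl (u : S) *
      Monoid.Coprod.inr (FreeGroup.of i) * (Monoid.Coprod.inl (φ i u : S))⁻¹}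

/-- The multiple HNN extension `⟨S, t_1, …, t_r | t_i⁻¹ u t_i = φ_i(u) for u ∈ P_i⟩`: the quotient
of the free product `S * T` by these relations. -/
abbrev MultipleHNN {S : Type*} [Group S] {r : ℕ} (P Q : Fin r → Subgroup S)
    (φ : (i : Fin r) → P i →* Q i) : Type _ :=
  Monoid.Coprod S (FreeGroup (Fin r)) ⧸ Subgroup.normalClosure (multipleHNNRelators P Q φ)

/-- The canonical homomorphism from `S` to the multiple HNN extension. -/
def MultipleHNN.of {S : Type*} [Group S] {r : ℕ} (P Q : Fin r → Subgroup S)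
    (φ : (i : Fin r) → P i →* Q i) : S →* MultipleHNN P Q φ :=
  (QuotientGroup.mk' (Subgroup.normalClosure (multipleHNNRelators P Q φ))).comp Monoid.Coprod.inl

/-- The subgroup `H` of `G` is conjugate in `G` to a subgroup of the image of `ι : S → G`. -/
def Subgroup.IsConjInto {S G : Type*} [Group S] [Group G] (H : Subgroup G) (ι : S →* G) : Prop :=
  ∃ (g : G) (K : Subgroup S), H.map (MulAut.conj g).toMonoidHom = K.map ι

/-!
Write `G` for the multiple HNN extension. Each `φ i : P i → S` is induced by conjugation in the
symmetric group of `S`: both `P i` and its image act freely on `S` by translations, with equally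
many orbits (`Subgroup.exists_perm_intertwining`). So the regular action of `S` extends to an action
`permRep` of `G` on `S`. Its kernel `N` is normal of index dividing `|S|!`.

The action lifts to the product of `S` with the free group `F` on the set of edges `k t_i S` of the
Bass–Serre tree that start at the vertex `S`, in such a way that `F` commutes with it
(`coverRep`). The orbit map of the point `(1, 1)` is a bijection from `G` to `F × S`: its inverse is
`(x, k) ↦ loop x * k`, where `loop : F → G` sends the edge `k t_i S` to `k t_i (τ_i k)⁻¹`. These
coordinates replace normal forms. They show that `S → G` and `loop` are injective and that `N` lies
in the image of `loop`, so `N` is free by the Nielsen–Schreier theorem.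

The first coordinate identifies `G ⧸ S` with `F`, and left multiplication by elements of `G` then
preserves the oriented edges of the Cayley tree of `F` (`MultipleHNN.vertexMap`). This is the
Bass–Serre tree of `G`, and the rest is geometry in it.

* A finite subgroup `H` fixes a vertex, that is, it is conjugate into `S`
  (`VertexMap.exists_forall_conj_mem`). The sum of the squared distances to the points of an orbit
  is `H`-invariant and strictly convex on the tree, so its minimisers have pairwise distance at
  most `1`; and an element that moves a minimiser along an oriented edge would have a square that
  moves it by distance `2`. The statement about finite `p`-subgroups is a special case.
* If `g` conjugates `A ≤ S` into `S`, then `A` fixes the vertices `S` and `g S`, hence the geodesic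
  between them. The stabiliser of the edge `t_i S` is `P i`, so the conjugation is a composite of
  restrictions of the maps `φ i`, their inverses, and conjugations in `S`, by induction on the
  length of the geodesic (`MultipleHNN.mem_of_conj`).
-/

/-! ### The metric of the Cayley tree of a free group -/

namespace FreeGroup

variable {E : Type*}

theorem inv_mk_singleton (l : E × Bool) : (mk [l])⁻¹ = mk [(l.1, !l.2)] := by
  simp [inv_mk, invRev]

theorem mk_singleton_false (e : E) : mk [(e, false)] = (of e)⁻¹ :=
  rfl

variable [DecidableEq E]

theorem norm_mk_singleton (l : E × Bool) : norm (mk [l]) = 1 := by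
  simp [norm]

theorem norm_mul_letter (x : FreeGroup E) (l : E × Bool) :
    norm (x * mk [l]) = norm x + 1 ∨ norm x = norm (x * mk [l]) + 1 := by
  obtain ⟨n, hn⟩ : ∃ n, (x.toWord ++ [l]).length = (x * mk [l]).toWord.length + 2 * n := by
    have h : (x * mk [l]).toWord = reduce (x.toWord ++ [l]) := by simp [toWord_mul]
    rw [h]
    exact reduce.red.length
  have h1 := norm_mul_le x (mk [l])
  have h2 := norm_mul_le (x * mk [l]) (mk [l])⁻¹
  rw [mul_inv_cancel_right] at h2
  rw [norm_inv_eq] at h2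
  rw [norm_mk_singleton] at h1 h2
  simp only [List.length_append, List.length_singleton] at hn
  simp only [norm] at *
  omega

/-- In the Cayley tree of a free group, each vertex has at most one neighbour that is nearer to
the base point. -/
theorem letter_eq_of_norm_lt {x : FreeGroup E} {l l' : E × Bool}
    (h : norm (x * mk [l]) < norm x) (h' : norm (x * mk [l']) < norm x) : l = l' := by
  have key : ∀ {m : E × Bool}, norm (x * mk [m]) < norm x →
      x.toWord = (x * mk [m]).toWord ++ [(m.1, !m.2)] := by
    intro m hm
    have hs := toWord_mul_sublist (x * mk [m]) (mk [m])⁻¹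
    rw [mul_inv_cancel_right, inv_mk_singleton] at hs
    have hw : (mk [(m.1, !m.2)] : FreeGroup E).toWord = [(m.1, !m.2)] := by simp
    rw [hw] at hs
    refine hs.eq_of_length_le ?_
    simp only [List.length_append, List.length_singleton]
    simp only [norm] at hm
    omega
  have e := (key h).symm.trans (key h')
  have e2 := (List.append_inj' e rfl).2
  simp only [List.cons.injEq, Prod.mk.injEq, and_true] at e2
  ext
  · exact e2.1
  · simpa using e2.2

theorem exists_eq_mul_letter {z : FreeGroup E} {n : ℕ} (hz : norm z = n + 1) :
    ∃ (x : FreeGroup E) (l : E × Bool), z = x * mk [l] ∧ norm x = n := by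
  obtain ⟨L, l, hL⟩ : ∃ L l, z.toWord = L ++ [l] := by
    have hne : z.toWord ≠ [] := by
      intro h0
      simp [norm, h0] at hz
    exact ⟨_, _, (List.dropLast_append_getLast hne).symm⟩
  have hr : IsReduced (L ++ [l]) := hL ▸ isReduced_toWord
  refine ⟨mk L, l, ?_, ?_⟩
  · rw [mul_mk, ← hL, mk_toWord]
  · have : (mk L).toWord = L := by
      rw [toWord_mk]
      exact (hr.infix ⟨[], [l], by simp⟩).reduce_eq
    rw [norm, this]
    have := congrArg List.length hL
    simp only [norm] at hz
    simp at this
    omega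

/-- The square of the distance to a point is strictly convex on the Cayley tree of a free group. -/
theorem two_mul_sq_norm_lt (y : FreeGroup E) {l l' : E × Bool} (hl : l ≠ l') :
    2 * norm y ^ 2 < norm (y * mk [l]) ^ 2 + norm (y * mk [l']) ^ 2 := by
  rcases norm_mul_letter y l with h | h <;> rcases norm_mul_letter y l' with h' | h'
  · rw [h, h']; nlinarith
  · rw [h, h']; nlinarith
  · rw [h, h']; nlinarith
  · exact absurd (letter_eq_of_norm_lt (x := y) (by omega) (by omega)) hl

/-- Any two vertices of the Cayley tree of a free group that minimise the sum of the squared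
distances to finitely many given vertices are at distance at most `1`. -/
theorem norm_le_one_of_minimizers {J : Type*} [Fintype J] [Nonempty J] (y : J → FreeGroup E)
    {u w : FreeGroup E}
    (hu : ∀ x, ∑ j, norm ((y j)⁻¹ * u) ^ 2 ≤ ∑ j, norm ((y j)⁻¹ * x) ^ 2)
    (hw : ∀ x, ∑ j, norm ((y j)⁻¹ * w) ^ 2 ≤ ∑ j, norm ((y j)⁻¹ * x) ^ 2) :
    norm (u⁻¹ * w) ≤ 1 := by
  set f : FreeGroup E → ℕ := fun x => ∑ j, norm ((y j)⁻¹ * x) ^ 2 with hf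
  have conv : ∀ x (l l' : E × Bool), l ≠ l' → 2 * f x < f (x * mk [l]) + f (x * mk [l']) := by
    intro x l l' hl
    simp only [hf, Finset.mul_sum, ← Finset.sum_add_distrib]
    refine Finset.sum_lt_sum_of_nonempty Finset.univ_nonempty fun j _ => ?_
    simp only [← mul_assoc]
    exact two_mul_sq_norm_lt ((y j)⁻¹ * x) hl
  -- By strict convexity, `f` keeps increasing along geodesics that start at the minimiser `u`.
  have step : ∀ n x l, norm x = n → norm (x * mk [l]) = n + 1 →
      f (u * x) ≤ f (u * (x * mk [l])) ∧ (n ≠ 0 → f (u * x) < f (u * (x * mk [l]))) := by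
    intro n
    induction n with
    | zero =>
      intro x l hx _
      rw [norm_eq_zero] at hx
      subst hx
      rw [mul_one]
      exact ⟨hu _, fun h => absurd rfl h⟩
    | succ n ih =>
      intro x l hx hxl
      obtain ⟨x', l', rfl, hx'⟩ := exists_eq_mul_letter hx
      have h1 := (ih x' l' hx' hx).1
      have hne : l ≠ (l'.1, !l'.2) := by
        rintro rfl
        rw [← inv_mk_singleton, mul_inv_cancel_right] at hxl
        omega
      have h2 := conv (u * (x' * mk [l'])) l _ hne
      rw [← inv_mk_singleton] at h2
      rw [mul_assoc u, ← mul_assoc u x', mul_inv_cancel_right, mul_assoc u x'] at h2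
      exact ⟨by omega, fun _ => by omega⟩
  by_contra hcon
  obtain ⟨n, hn⟩ : ∃ n, norm (u⁻¹ * w) = n + 1 + 1 := ⟨norm (u⁻¹ * w) - 2, by omega⟩
  obtain ⟨x, l, hxl, hx⟩ := exists_eq_mul_letter hn
  have h3 := (step _ x l hx (hxl ▸ hn)).2 (by omega)
  rw [← hxl, mul_inv_cancel_left] at h3
  have h4 := hw (u * x)
  change f w ≤ f (u * x) at h4
  omega

theorem norm_of_mul_of (e e' : E) : norm (of e * of e') = 2 := by
  have h : (of e * of e' : FreeGroup E) = mk [(e, true), (e', true)] := rfl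
  rw [h, norm, toWord_mk, IsReduced.reduce_eq (by simp)]
  rfl

end FreeGroup

/-! ### Groups acting on the Cayley tree of a free group -/

open FreeGroup in
/-- A description of `G ⧸ L` as the vertex set of the Cayley tree of the free group on `E`, by its
composite with `G → G ⧸ L`, such that left multiplication by elements of `G` preserves the oriented
edges `x ⟶ x * e`, where `e ∈ E`. -/
structure VertexMap {G : Type*} [Group G] (L : Subgroup G) (E : Type*) where
  /-- The vertex `g L`. -/
  toFun : G → FreeGroup E
  surjective : Function.Surjective toFun
  eq_iff : ∀ {g g' : G}, toFun g = toFun g' ↔ g⁻¹ * g' ∈ L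
  edge : ∀ (h : G) {g g' : G} {e : E}, toFun g' = toFun g * of e →
    ∃ e', toFun (h * g') = toFun (h * g) * of e'

namespace VertexMap

open FreeGroup

variable {G : Type*} [Group G] {L : Subgroup G} {E : Type*}

theorem mul_eq_mul (v : VertexMap L E) (h : G) {g g' : G} (hg : v.toFun g = v.toFun g') :
    v.toFun (h * g) = v.toFun (h * g') := by
  rw [v.eq_iff] at hg ⊢
  simpa [mul_assoc] using hg

theorem exists_letter (v : VertexMap L E) (h : G) {g g' : G} {l : E × Bool}
    (hg : v.toFun g' = v.toFun g * FreeGroup.mk [l]) :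
    ∃ l', v.toFun (h * g') = v.toFun (h * g) * FreeGroup.mk [l'] := by
  obtain ⟨e, b⟩ := l
  cases b
  · have h1 : v.toFun g = v.toFun g' * of e := by
      rw [hg, mk_singleton_false, inv_mul_cancel_right]
    obtain ⟨e', he'⟩ := v.edge h h1
    exact ⟨(e', false), by rw [he', mk_singleton_false, mul_inv_cancel_right]⟩
  · obtain ⟨e', he'⟩ := v.edge h hg
    exact ⟨(e', true), he'⟩

section DecidableEq

variable [DecidableEq E]

theorem norm_mul_le (v : VertexMap L E) (h g g' : G) :
    norm ((v.toFun (h * g))⁻¹ * v.toFun (h * g')) ≤ norm ((v.toFun g)⁻¹ * v.toFun g') := by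
  generalize hn : norm ((v.toFun g)⁻¹ * v.toFun g') = n
  induction n generalizing g' with
  | zero =>
    rw [FreeGroup.norm_eq_zero, inv_mul_eq_one] at hn
    simp [v.mul_eq_mul h hn]
  | succ n ih =>
    obtain ⟨x, l, hx, hxn⟩ := exists_eq_mul_letter hn
    obtain ⟨g₁, hg₁⟩ := v.surjective (v.toFun g * x)
    have h1 := ih g₁ (by rw [hg₁, inv_mul_cancel_left, hxn])
    have h2 : v.toFun g' = v.toFun g₁ * FreeGroup.mk [l] := by
      rw [hg₁, mul_assoc, ← hx, mul_inv_cancel_left]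
    obtain ⟨l', hl'⟩ := v.exists_letter h h2
    rw [hl', ← mul_assoc]
    refine (FreeGroup.norm_mul_le _ _).trans ?_
    rw [norm_mk_singleton]
    omega

/-- `G` acts by isometries on the tree. -/
theorem norm_mul (v : VertexMap L E) (h g g' : G) :
    norm ((v.toFun (h * g))⁻¹ * v.toFun (h * g')) = norm ((v.toFun g)⁻¹ * v.toFun g') := by
  refine le_antisymm (v.norm_mul_le h g g') ?_
  simpa using v.norm_mul_le h⁻¹ (h * g) (h * g')

/-- An element of `G` that fixes both ends of a geodesic from the base point `L` fixes its
penultimate vertex. -/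
theorem mul_eq_of_mul_eq (v : VertexMap L E) {h g g' : G} {l : E × Bool} (hone : v.toFun 1 = 1)
    (hh : h ∈ L) (hg : v.toFun g = v.toFun g' * FreeGroup.mk [l])
    (hnorm : norm (v.toFun g) = norm (v.toFun g') + 1) (hfix : v.toFun (h * g) = v.toFun g) :
    v.toFun (h * g') = v.toFun g' := by
  have hh1 : v.toFun (h * 1) = 1 := by
    rw [← hone, eq_comm, v.eq_iff]
    simpa using hh
  have h1 : norm (v.toFun (h * g')) = norm (v.toFun g') := by
    have := v.norm_mul h 1 g'
    rwa [hh1, hone, inv_one, one_mul, one_mul] at this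
  obtain ⟨l', hl'⟩ := v.exists_letter h hg
  have e1 : v.toFun g' = v.toFun g * FreeGroup.mk [(l.1, !l.2)] := by
    rw [hg, ← inv_mk_singleton, mul_inv_cancel_right]
  have e2 : v.toFun (h * g') = v.toFun g * FreeGroup.mk [(l'.1, !l'.2)] := by
    rw [← hfix, hl', ← inv_mk_singleton, mul_inv_cancel_right]
  have h3 := letter_eq_of_norm_lt (x := v.toFun g) (l := (l.1, !l.2)) (l' := (l'.1, !l'.2))
    (by rw [← e1]; omega) (by rw [← e2]; omega)
  rw [e1, e2, h3]

end DecidableEq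

/-- A finite group acting on a tree without inversions fixes a vertex. -/
theorem exists_forall_conj_mem (v : VertexMap L E) (H : Subgroup G) [Finite H] :
    ∃ g : G, ∀ h ∈ H, g⁻¹ * h * g ∈ L := by
  classical
  have := Fintype.ofFinite H
  obtain ⟨g, hg⟩ : ∃ g : G, ∀ g' : G, ∑ h : H, norm ((v.toFun h)⁻¹ * v.toFun g) ^ 2 ≤
      ∑ h : H, norm ((v.toFun h)⁻¹ * v.toFun g') ^ 2 :=
    ⟨_, fun g' => Function.argmin_le
      (fun g' : G => ∑ h : H, norm ((v.toFun h)⁻¹ * v.toFun g') ^ 2) g'⟩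
  have hmin : ∀ k ∈ H, ∀ x, ∑ h : H, norm ((v.toFun h)⁻¹ * v.toFun (k * g)) ^ 2 ≤
      ∑ h : H, norm ((v.toFun h)⁻¹ * x) ^ 2 := by
    intro k hk x
    obtain ⟨g', rfl⟩ := v.surjective x
    refine le_trans (le_of_eq ?_) (hg g')
    rw [← Equiv.sum_comp (Equiv.mulLeft (⟨k, hk⟩ : H))]
    exact Finset.sum_congr rfl fun h _ => congrArg (· ^ 2) (v.norm_mul k h g)
  have hdist : ∀ k ∈ H, norm ((v.toFun g)⁻¹ * v.toFun (k * g)) ≤ 1 := fun k hk =>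
    norm_le_one_of_minimizers (fun h : H => v.toFun h)
      (by simpa using hmin 1 H.one_mem) (hmin k hk)
  -- If `k` moved the minimiser along an oriented edge, then `k ^ 2` would move it by distance `2`.
  have hedge : ∀ k ∈ H, ∀ e, v.toFun (k * g) ≠ v.toFun g * of e := by
    intro k hk e he
    obtain ⟨e', he'⟩ := v.edge k he
    have h2 := hdist (k * k) (H.mul_mem hk hk)
    rw [mul_assoc, he', he, mul_assoc, inv_mul_cancel_left, norm_of_mul_of] at h2
    omega
  refine ⟨g, fun k hk => ?_⟩
  rw [mul_assoc, ← v.eq_iff]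
  by_contra hne
  have h1 : norm ((v.toFun g)⁻¹ * v.toFun (k * g)) = 0 + 1 := by
    refine le_antisymm (hdist k hk) (Nat.one_le_iff_ne_zero.mpr fun h0 => hne ?_)
    rwa [FreeGroup.norm_eq_zero, inv_mul_eq_one] at h0
  obtain ⟨x, ⟨e, b⟩, hx, hx0⟩ := exists_eq_mul_letter h1
  rw [FreeGroup.norm_eq_zero] at hx0
  rw [hx0, one_mul, inv_mul_eq_iff_eq_mul] at hx
  cases b
  · have h2 : v.toFun g = v.toFun (k * g) * of e := by
      rw [hx, mk_singleton_false, inv_mul_cancel_right]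
    obtain ⟨e', he'⟩ := v.edge k⁻¹ h2
    rw [inv_mul_cancel_left] at he'
    exact hedge k⁻¹ (H.inv_mem hk) e' he'
  · exact hedge k hk e hx

end VertexMap

/-! ### The multiple HNN extension -/

namespace Subgroup

/-- An injective homomorphism `φ` from a subgroup `P` of a finite group `S` to `S` is induced by
conjugation in the group of permutations of `S`: some permutation of `S` intertwines the right
translations by `u` and by `φ u`, for `u ∈ P`. -/
theorem exists_perm_intertwining {S : Type*} [Group S] [Finite S] {P Q : Subgroup S}
    (φ : P →* Q) (hφ : Function.Injective φ) :
    ∃ τ : Equiv.Perm S, ∀ (k : S) (u : P), τ (k * u) = τ k * φ u := by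
  have hψ : Function.Injective (Q.subtype.comp φ) := Q.subtype_injective.comp hφ
  set R := (Q.subtype.comp φ).range with hR
  have hcard : Nat.card (S ⧸ P) = Nat.card (S ⧸ R) := by
    have h1 := P.card_mul_index
    rw [← R.card_mul_index, ← Nat.card_congr (MonoidHom.ofInjective hψ).toEquiv] at h1
    exact Nat.eq_of_mul_eq_mul_left Nat.card_pos h1
  obtain ⟨β⟩ : Nonempty ((S ⧸ P) ≃ (S ⧸ R)) := Finite.card_eq.1 hcard
  have hmem : ∀ k : S, (k : S ⧸ P).out⁻¹ * k ∈ P := fun k =>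
    QuotientGroup.eq.1 (QuotientGroup.out_eq' _)
  set τ : S → S := fun k => (β k).out * φ ⟨_, hmem k⟩ with hτ
  have hβ : ∀ k, (τ k : S ⧸ R) = β k := fun k => by
    rw [hτ, QuotientGroup.mk_mul_of_mem _ (⟨_, rfl⟩ : _ ∈ R), QuotientGroup.out_eq']
  have hinj : Function.Injective τ := by
    intro k k' h
    have h1 : (k : S ⧸ P) = (k' : S ⧸ P) := β.injective (by rw [← hβ, ← hβ, h])
    simp only [hτ, h1, mul_right_inj, SetLike.coe_eq_coe] at h
    simpa using hφ h
  refine ⟨Equiv.ofBijective τ hinj.bijective_of_finite, fun k u => ?_⟩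
  have h1 : ((k * u : S) : S ⧸ P) = k := QuotientGroup.mk_mul_of_mem _ u.2
  simp only [Equiv.ofBijective_apply, hτ, mul_assoc, h1]
  rw [← Subgroup.coe_mul, ← map_mul]
  congr 3
  ext
  simp [mul_assoc]

end Subgroup

namespace MultipleHNN

variable {S : Type*} [Group S] {r : ℕ} (P Q : Fin r → Subgroup S) (φ : (i : Fin r) → P i →* Q i)

/-- The stable letter `t_i`. -/
def stable (i : Fin r) : MultipleHNN P Q φ :=
  QuotientGroup.mk' _ (Monoid.Coprod.inr (FreeGroup.of i))

theorem stable_conj (i : Fin r) (u : P i) :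
    (stable P Q φ i)⁻¹ * of P Q φ u * stable P Q φ i = of P Q φ (φ i u) := by
  rw [← mul_inv_eq_one]
  exact (QuotientGroup.eq_one_iff _).2 (Subgroup.subset_normalClosure ⟨i, u, rfl⟩)

variable {P Q φ}

/-- The universal property of the multiple HNN extension. -/
def lift {K : Type*} [Group K] (f : S →* K) (t : Fin r → K)
    (h : ∀ i (u : P i), (t i)⁻¹ * f u * t i = f (φ i u)) : MultipleHNN P Q φ →* K :=
  QuotientGroup.lift _ (Monoid.Coprod.lift f (FreeGroup.lift t)) <| by
    refine Subgroup.normalClosure_le_normal (N := MonoidHom.ker _) ?_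
    rintro _ ⟨i, u, rfl⟩
    simp [MonoidHom.mem_ker, h]

@[simp]
theorem lift_of {K : Type*} [Group K] (f : S →* K) (t : Fin r → K)
    (h : ∀ i (u : P i), (t i)⁻¹ * f u * t i = f (φ i u)) (s : S) :
    lift f t h (of P Q φ s) = f s := by
  simp [lift, of]

@[simp]
theorem lift_stable {K : Type*} [Group K] (f : S →* K) (t : Fin r → K)
    (h : ∀ i (u : P i), (t i)⁻¹ * f u * t i = f (φ i u)) (i : Fin r) :
    lift f t h (stable P Q φ i) = t i := by
  simp [lift, stable]

theorem eq_top_of_generators_mem (K : Subgroup (MultipleHNN P Q φ)) (hS : ∀ s, of P Q φ s ∈ K)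
    (ht : ∀ i, stable P Q φ i ∈ K) : K = ⊤ := by
  rw [eq_top_iff]
  rintro g -
  obtain ⟨w, rfl⟩ := QuotientGroup.mk'_surjective _ g
  induction w using Monoid.Coprod.induction_on with
  | inl s => exact hS s
  | inr w =>
    induction w using FreeGroup.induction_on with
    | C1 => simp
    | of i => exact ht i
    | inv_of i hi => simpa using hi
    | mul x y hx hy => simpa using K.mul_mem hx hy
  | mul x y hx hy => simpa using K.mul_mem hx hy

/-! ### The regular action of `S`, extended to the multiple HNN extension -/

/-- The action of `S` on itself by right translations, turned into a left action. -/
def rightTranslation : S →* Equiv.Perm S where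
  toFun s := Equiv.mulRight s⁻¹
  map_one' := by ext; simp
  map_mul' s s' := by ext; simp [mul_assoc]

/-- The action of the multiple HNN extension on `S` in which `S` acts by right translations and
`t_i` acts by the inverse of a permutation `τ i` as in `Subgroup.exists_perm_intertwining`. -/
def permRep (τ : Fin r → Equiv.Perm S) (hτ : ∀ i k (u : P i), τ i (k * u) = τ i k * φ i u) :
    MultipleHNN P Q φ →* Equiv.Perm S :=
  lift rightTranslation (fun i => (τ i)⁻¹) fun i u => by
    rw [inv_inv, mul_inv_eq_iff_eq_mul]
    ext k
    simpa [rightTranslation] using hτ i k u⁻¹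

variable (P) in
/-- The edges `k t_i S`, with `k ∈ S`, that leave the base vertex `S` of the Bass–Serre tree. They
index free generators of the stabiliser of a point under `permRep`. -/
abbrev Edge : Type _ := Σ i, S ⧸ P i

/-- `rightTranslation` on the second factor of a product. -/
def rightTranslationProd (X : Type*) : S →* Equiv.Perm (X × S) where
  toFun s := (Equiv.refl X).prodCongr (rightTranslation s)
  map_one' := by ext <;> simp
  map_mul' s s' := by ext <;> simp

/-- The permutation `(x, k) ↦ (x e, τ_i k)`, where `e` is the edge `k t_i S`. -/
def stablePerm (τ : Fin r → Equiv.Perm S) (i : Fin r) :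
    Equiv.Perm (FreeGroup (Edge P) × S) where
  toFun p := (p.1 * FreeGroup.of ⟨i, p.2⟩, τ i p.2)
  invFun p := (p.1 * (FreeGroup.of ⟨i, ((τ i).symm p.2 : S)⟩)⁻¹, (τ i).symm p.2)
  left_inv p := by simp
  right_inv p := by simp

variable {τ : Fin r → Equiv.Perm S} (hτ : ∀ i k (u : P i), τ i (k * u) = τ i k * φ i u)

/-- The lift of `permRep` to the product of the free group on `Edge P` with `S`. It corresponds to
the right multiplication of `MultipleHNN P Q φ` on itself when `(x, k)` stands for `loop τ x * k`;
as a left action, it is the action of the inverse. -/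
def coverRep : MultipleHNN P Q φ →* Equiv.Perm (FreeGroup (Edge P) × S) :=
  lift (rightTranslationProd _) (fun i => (stablePerm τ i)⁻¹) fun i u => by
    rw [inv_inv, mul_inv_eq_iff_eq_mul]
    have h1 : ∀ k : S, ((k * (u : S)⁻¹ : S) : S ⧸ P i) = k := fun k =>
      QuotientGroup.mk_mul_of_mem _ (inv_mem u.2)
    have h2 := fun k => hτ i k u⁻¹
    ext ⟨x, k⟩
    · simp [rightTranslationProd, rightTranslation, stablePerm, h1]
    · simpa [rightTranslationProd, rightTranslation, stablePerm] using h2 k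

/-- The pair `(x, k)` with `g = loop τ x * k`. -/
def coord (g : MultipleHNN P Q φ) : FreeGroup (Edge P) × S :=
  (coverRep hτ g)⁻¹ (1, 1)

theorem coverRep_inv_of (s : S) (p : FreeGroup (Edge P) × S) :
    (coverRep hτ (of P Q φ s))⁻¹ p = (p.1, p.2 * s) := by
  rw [Equiv.Perm.inv_eq_iff_eq]
  ext <;> simp [coverRep, rightTranslationProd, rightTranslation]

theorem coverRep_inv_stable (i : Fin r) (p : FreeGroup (Edge P) × S) :
    (coverRep hτ (stable P Q φ i))⁻¹ p = (p.1 * FreeGroup.of ⟨i, p.2⟩, τ i p.2) := by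
  simp [coverRep, stablePerm]

theorem coord_mul_of (g : MultipleHNN P Q φ) (s : S) :
    coord hτ (g * of P Q φ s) = ((coord hτ g).1, (coord hτ g).2 * s) := by
  rw [coord, map_mul, mul_inv_rev, Equiv.Perm.mul_apply, coverRep_inv_of]
  rfl

theorem coord_mul_stable (g : MultipleHNN P Q φ) (i : Fin r) :
    coord hτ (g * stable P Q φ i) =
      ((coord hτ g).1 * FreeGroup.of ⟨i, (coord hτ g).2⟩, τ i (coord hτ g).2) := by
  rw [coord, map_mul, mul_inv_rev, Equiv.Perm.mul_apply, coverRep_inv_stable]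
  rfl

theorem coord_one : coord hτ 1 = 1 := by
  simp [coord]

theorem coord_of (s : S) : coord hτ (of P Q φ s) = (1, s) := by
  simpa [coord_one] using coord_mul_of hτ 1 s

theorem of_injective (hτ : ∀ i k (u : P i), τ i (k * u) = τ i k * φ i u) :
    Function.Injective (of P Q φ) := by
  intro s s' h
  have h1 := coord_of hτ s
  rw [h, coord_of] at h1
  exact (congrArg Prod.snd h1).symm

theorem permRep_apply_snd (g : MultipleHNN P Q φ) (p : FreeGroup (Edge P) × S) :
    permRep τ hτ g p.2 = (coverRep hτ g p).2 := by
  let K : Subgroup (MultipleHNN P Q φ) :=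
    { carrier := {g | ∀ p, permRep τ hτ g p.2 = (coverRep hτ g p).2}
      one_mem' := fun p => by simp
      mul_mem' := fun {g g'} hg hg' p => by
        rw [map_mul, map_mul, Equiv.Perm.mul_apply, Equiv.Perm.mul_apply, hg', hg]
      inv_mem' := fun {g} hg p => by
        rw [map_inv, map_inv, Equiv.Perm.inv_eq_iff_eq, hg]
        simp }
  have hK : K = ⊤ := eq_top_of_generators_mem K
    (fun s p => by simp [permRep, coverRep, rightTranslationProd])
    (fun i p => by simp [permRep, coverRep, stablePerm])
  exact (hK ▸ Subgroup.mem_top g : g ∈ K) p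

/-! ### The free point stabiliser -/

variable (P Q φ) in
/-- The element `k t_i (τ_i k)⁻¹`, which fixes the base point of `S` under `permRep`. -/
def loopGen (τ : Fin r → Equiv.Perm S) (i : Fin r) (k : S) : MultipleHNN P Q φ :=
  of P Q φ k * stable P Q φ i * (of P Q φ (τ i k))⁻¹

theorem loopGen_mul (hτ : ∀ i k (u : P i), τ i (k * u) = τ i k * φ i u)
    (i : Fin r) (k : S) (u : P i) :
    loopGen P Q φ τ i (k * u) = loopGen P Q φ τ i k := by
  rw [loopGen, loopGen, hτ, map_mul, map_mul, ← stable_conj]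
  group

variable (P Q φ) in
/-- The homomorphism from the free group on `Edge P` that sends the edge `k t_i S` to
`k t_i (τ_i k)⁻¹`. The definition uses a chosen representative `k`; by `loopGen_mul`, the value does
not depend on it. -/
noncomputable def loop (τ : Fin r → Equiv.Perm S) : FreeGroup (Edge P) →* MultipleHNN P Q φ :=
  FreeGroup.lift fun e => loopGen P Q φ τ e.1 e.2.out

theorem loop_of (hτ : ∀ i k (u : P i), τ i (k * u) = τ i k * φ i u)
    (i : Fin r) (k : S) :
    loop P Q φ τ (FreeGroup.of ⟨i, k⟩) = loopGen P Q φ τ i k := by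
  obtain ⟨u, hu⟩ := QuotientGroup.mk_out_eq_mul (P i) k
  simp only [loop, FreeGroup.lift_apply_of]
  rw [hu, loopGen_mul hτ]

theorem loop_mul_of_coord (g : MultipleHNN P Q φ) :
    loop P Q φ τ (coord hτ g).1 * of P Q φ (coord hτ g).2 = g := by
  let K : Subgroup (MultipleHNN P Q φ) :=
    { carrier := {g | ∀ p, loop P Q φ τ ((coverRep hτ g)⁻¹ p).1 *
        of P Q φ ((coverRep hτ g)⁻¹ p).2 = loop P Q φ τ p.1 * of P Q φ p.2 * g}
      one_mem' := fun p => by simp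
      mul_mem' := fun {g g'} hg hg' p => by
        rw [map_mul, mul_inv_rev, Equiv.Perm.mul_apply, hg', hg, mul_assoc]
      inv_mem' := fun {g} hg p => by
        have h1 := hg (coverRep hτ g p)
        rw [← Equiv.Perm.mul_apply, inv_mul_cancel, Equiv.Perm.one_apply] at h1
        rw [map_inv, inv_inv, h1, mul_inv_cancel_right] }
  have hK : K = ⊤ := by
    refine eq_top_of_generators_mem K (fun s p => ?_) (fun i p => ?_)
    · rw [coverRep_inv_of, map_mul, mul_assoc]
    · rw [coverRep_inv_stable, map_mul, loop_of hτ, loopGen]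
      group
  have h := (hK ▸ Subgroup.mem_top g : g ∈ K) (1, 1)
  rwa [map_one, map_one, mul_one, one_mul] at h

theorem coverRep_inv_loop (x y : FreeGroup (Edge P)) :
    (coverRep hτ (loop P Q φ τ x))⁻¹ (y, 1) = (y * x, 1) := by
  induction x using FreeGroup.induction_on generalizing y with
  | C1 => simp
  | of e =>
    obtain ⟨i, c⟩ := e
    obtain ⟨k, rfl⟩ := QuotientGroup.mk_surjective c
    rw [loop_of hτ, loopGen, map_mul, map_mul, mul_inv_rev, mul_inv_rev,
      ← map_inv (of P Q φ), Equiv.Perm.mul_apply, Equiv.Perm.mul_apply, coverRep_inv_of,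
      coverRep_inv_stable, coverRep_inv_of]
    simp
  | inv_of e h =>
    rw [map_inv, map_inv, inv_inv, ← Equiv.Perm.eq_inv_iff_eq, h]
    simp
  | mul x x' h h' =>
    rw [map_mul, map_mul, mul_inv_rev, Equiv.Perm.mul_apply, h, h', mul_assoc]

theorem coord_loop (x : FreeGroup (Edge P)) : coord hτ (loop P Q φ τ x) = (x, 1) := by
  rw [coord, coverRep_inv_loop, one_mul]

theorem isFreeGroup_ker_permRep : IsFreeGroup (permRep τ hτ).ker := by
  have hinj : Function.Injective (loop P Q φ τ) := by
    intro x y h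
    have h1 := coord_loop hτ x
    rw [h, coord_loop] at h1
    exact (congrArg Prod.fst h1).symm
  have hle : (permRep τ hτ).ker ≤ (loop P Q φ τ).range := by
    intro g hg
    refine ⟨(coord hτ g).1, ?_⟩
    have h1 : (coord hτ g).2 = 1 := by
      rw [coord, ← map_inv, ← permRep_apply_snd, map_inv, MonoidHom.mem_ker.1 hg]
      simp
    have h2 := loop_mul_of_coord hτ g
    rwa [h1, map_one, mul_one] at h2
  have e := ((permRep τ hτ).ker.comap (loop P Q φ τ)).equivMapOfInjective _ hinj
  rw [Subgroup.map_comap_eq_self hle] at e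
  exact IsFreeGroup.ofMulEquiv e

/-! ### The Bass–Serre tree -/

theorem exists_mul_of_coord_fst_eq {g g' : MultipleHNN P Q φ}
    (h : (coord hτ g).1 = (coord hτ g').1) : ∃ s, g' = g * of P Q φ s := by
  refine ⟨(coord hτ g).2⁻¹ * (coord hτ g').2, ?_⟩
  have h1 := loop_mul_of_coord hτ g'
  rw [← h] at h1
  rw [map_mul, map_inv, ← mul_assoc, mul_inv_eq_of_eq_mul (loop_mul_of_coord hτ g).symm, h1]

/-- An edge of the Bass–Serre tree from `g S` to `g' S` amounts to an equation `g' = g s t_i s'`. -/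
theorem exists_eq_of_coord_fst_eq {g g' : MultipleHNN P Q φ} {e : Edge P}
    (h : (coord hτ g').1 = (coord hτ g).1 * FreeGroup.of e) :
    ∃ i s s', g' = g * of P Q φ s * stable P Q φ i * of P Q φ s' := by
  obtain ⟨i, c⟩ := e
  obtain ⟨k, rfl⟩ := QuotientGroup.mk_surjective c
  have h1 : (coord hτ (g * of P Q φ ((coord hτ g).2⁻¹ * k) * stable P Q φ i)).1 =
      (coord hτ g').1 := by
    rw [coord_mul_stable, coord_mul_of, mul_inv_cancel_left, h]
  exact ⟨i, _, exists_mul_of_coord_fst_eq hτ h1⟩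

/-- The Bass–Serre tree, with the Cayley tree of the free group on `Edge P` as a model: the vertex
`g S` is the first coordinate of `g`. -/
def vertexMap : VertexMap (of P Q φ).range (Edge P) where
  toFun g := (coord hτ g).1
  surjective x := ⟨loop P Q φ τ x, congrArg Prod.fst (coord_loop hτ x)⟩
  eq_iff := by
    intro g g'
    constructor
    · intro h
      obtain ⟨s, rfl⟩ := exists_mul_of_coord_fst_eq hτ h
      exact ⟨s, (inv_mul_cancel_left _ _).symm⟩
    · rintro ⟨s, hs⟩
      rw [eq_inv_mul_iff_mul_eq] at hs
      rw [← hs, coord_mul_of]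
  edge := by
    intro h g g' e he
    obtain ⟨i, s, s', rfl⟩ := exists_eq_of_coord_fst_eq hτ he
    exact ⟨_, by rw [← mul_assoc, ← mul_assoc, ← mul_assoc, coord_mul_of, coord_mul_stable,
      coord_mul_of]⟩

theorem vertexMap_mul_of (g : MultipleHNN P Q φ) (s : S) :
    (vertexMap hτ).toFun (g * of P Q φ s) = (vertexMap hτ).toFun g := by
  simp [vertexMap, coord_mul_of]

theorem vertexMap_one : (vertexMap hτ).toFun 1 = 1 := by
  simp [vertexMap, coord_one]

/-- The stabiliser of the edge `t_i S` is `P i`. -/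
theorem mem_of_conj_stable_eq (hτ : ∀ i k (u : P i), τ i (k * u) = τ i k * φ i u) {i : Fin r}
    {s s' : S}
    (h : (stable P Q φ i)⁻¹ * of P Q φ s * stable P Q φ i = of P Q φ s') :
    ∃ hs : s ∈ P i, (φ i ⟨s, hs⟩ : S) = s' := by
  have h1 : of P Q φ s * stable P Q φ i = 1 * stable P Q φ i * of P Q φ s' := by
    rw [← h]
    group
  have h2 := congrArg (fun g => (coord hτ g).1) h1
  simp only [coord_mul_stable, coord_mul_of, coord_of, coord_one] at h2
  have hs : s ∈ P i := by
    have h3 := FreeGroup.of_injective (mul_left_cancel h2)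
    simpa [QuotientGroup.eq] using h3.symm
  refine ⟨hs, of_injective hτ ?_⟩
  rw [← h]
  exact (stable_conj P Q φ i ⟨s, hs⟩).symm

end MultipleHNN

/-! ### Fusion -/

namespace FusionSystem

variable {S : Type*} [Group S] (F : FusionSystem S)

/-- Whether a homomorphism is a morphism depends on its values only, not on its codomain. -/
theorem mem_of_val_eq {A B C : Subgroup S} {f : A →* B} {f' : A →* C} (hf : f ∈ F.Hom A B)
    (h : ∀ u, (f' u : S) = f u) : f' ∈ F.Hom A C := by
  have hinj : Function.Injective (B.subtype.comp f) :=
    B.subtype_injective.comp (F.injective_of_mem f hf)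
  have h1 := (F.corestrict_mem f (MonoidHom.ofInjective hinj) hf fun _ => rfl).1
  have hle : (B.subtype.comp f).range ≤ C := by
    rintro _ ⟨u, rfl⟩
    have h1 := (f' u).2
    rwa [h u] at h1
  have h2 := F.comp_mem _ _ h1 (F.conj_mem (Subgroup.inclusion hle) 1 (by simp))
  convert h2 using 1
  ext u
  exact h u

theorem mem_of_comp_mem {A C D : Subgroup S} {f : C →* D} {k : A →* C} (hf : f ∈ F.Hom C D)
    (hfk : f.comp k ∈ F.Hom A D) : k ∈ F.Hom A C := by
  have hinj : Function.Injective (D.subtype.comp f) :=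
    D.subtype_injective.comp (F.injective_of_mem f hf)
  set e := MonoidHom.ofInjective hinj
  have h1 : e.toMonoidHom.comp k ∈ F.Hom A _ := F.mem_of_val_eq hfk fun _ => rfl
  have h2 := F.comp_mem _ _ h1 (F.corestrict_mem f e hf fun _ => rfl).2
  convert h2 using 1
  ext u
  simp

end FusionSystem

/-- A conjugation by an element of `G` that maps `A` into `S` is a homomorphism `A → S`. -/
theorem exists_hom_of_conj_mem_range {S G : Type*} [Group S] [Group G] {ι : S →* G}
    (hι : Function.Injective ι) (A : Subgroup S) {g : G}
    (h : ∀ u ∈ A, g⁻¹ * ι u * g ∈ ι.range) :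
    ∃ f : A →* (⊤ : Subgroup S), ∀ u : A, ι (f u) = g⁻¹ * ι u * g := by
  choose! f hf using h
  refine ⟨⟨⟨fun u => ⟨f u, Subgroup.mem_top _⟩, ?_⟩, ?_⟩, fun u => hf u u.2⟩
  · ext
    apply hι
    simp [hf 1 A.one_mem]
  · intro u u'
    ext
    apply hι
    simp only [Subgroup.coe_mul, MulMemClass.mk_mul_mk, map_mul]
    rw [hf _ u.2, hf _ u'.2, hf _ (A.mul_mem u.2 u'.2), map_mul]
    group

namespace MultipleHNN

variable {S : Type*} [Group S] {r : ℕ} {P Q : Fin r → Subgroup S} {φ : (i : Fin r) → P i →* Q i}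
  {τ : Fin r → Equiv.Perm S}

/-- Conjugation by an element `g' t_i s` of the multiple HNN extension is a morphism as soon as
conjugation by `g'` is, because `P i` is the stabiliser of the edge `t_i S`. -/
theorem mem_of_conj_mul_stable (hτ : ∀ i k (u : P i), τ i (k * u) = τ i k * φ i u)
    {F : FusionSystem S} (hF : ∀ i, φ i ∈ F.Hom (P i) (Q i)) {A B : Subgroup S} {f : A →* B}
    {f' : A →* (⊤ : Subgroup S)} (hf' : f' ∈ F.Hom A ⊤) {g' : MultipleHNN P Q φ} {i : Fin r} {s : S}
    (hf'g : ∀ u : A, of P Q φ (f' u : S) = g'⁻¹ * of P Q φ u * g')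
    (hf : ∀ u : A, of P Q φ (f u : S) = (g' * stable P Q φ i * of P Q φ s)⁻¹ * of P Q φ u *
      (g' * stable P Q φ i * of P Q φ s)) : f ∈ F.Hom A B := by
  have h1 : ∀ u : A, ∃ hu : (f' u : S) ∈ P i, (φ i ⟨f' u, hu⟩ : S) = s * f u * s⁻¹ := fun u => by
    apply mem_of_conj_stable_eq hτ
    rw [map_mul, map_mul, hf, hf'g, map_inv]
    group
  let k : A →* P i := ((⊤ : Subgroup S).subtype.comp f').codRestrict (P i) fun u => (h1 u).1
  have hk : k ∈ F.Hom A (P i) := F.mem_of_val_eq hf' fun _ => rfl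
  let c : Q i →* (⊤ : Subgroup S) :=
    ((MulAut.conj s⁻¹).toMonoidHom.comp (Q i).subtype).codRestrict ⊤ fun _ => Subgroup.mem_top _
  have hc : c ∈ F.Hom (Q i) ⊤ := F.conj_mem c s fun u => by simp [c]
  refine F.mem_of_val_eq (F.comp_mem _ _ (F.comp_mem _ _ hk (hF i)) hc) fun u => ?_
  obtain ⟨hu, hu'⟩ := h1 u
  have h2 : (((c.comp ((φ i).comp k)) u : (⊤ : Subgroup S)) : S) = s⁻¹ * φ i ⟨f' u, hu⟩ * s := by
    simp [c]
    rfl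
  rw [h2, hu']
  group

/-- The counterpart of `mem_of_conj_mul_stable` for `g' t_i⁻¹ s`. -/
theorem mem_of_conj_mul_stable_inv (hτ : ∀ i k (u : P i), τ i (k * u) = τ i k * φ i u)
    {F : FusionSystem S} (hF : ∀ i, φ i ∈ F.Hom (P i) (Q i)) {A B : Subgroup S} {f : A →* B}
    {f' : A →* (⊤ : Subgroup S)} (hf' : f' ∈ F.Hom A ⊤) {g' : MultipleHNN P Q φ} {i : Fin r} {s : S}
    (hf'g : ∀ u : A, of P Q φ (f' u : S) = g'⁻¹ * of P Q φ u * g')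
    (hf : ∀ u : A, of P Q φ (f u : S) = (g' * (stable P Q φ i)⁻¹ * of P Q φ s)⁻¹ * of P Q φ u *
      (g' * (stable P Q φ i)⁻¹ * of P Q φ s)) : f ∈ F.Hom A B := by
  have h1 : ∀ u : A, ∃ hu : s * (f u : S) * s⁻¹ ∈ P i, (φ i ⟨_, hu⟩ : S) = f' u := fun u => by
    apply mem_of_conj_stable_eq hτ
    rw [map_mul, map_mul, hf, hf'g, map_inv]
    group
  let k : A →* P i :=
    ((MulAut.conj s).toMonoidHom.comp (B.subtype.comp f)).codRestrict (P i) fun u => (h1 u).1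
  have hk : k ∈ F.Hom A (P i) :=
    F.mem_of_comp_mem (hF i) (F.mem_of_val_eq hf' fun u => (h1 u).2)
  let c : P i →* (⊤ : Subgroup S) :=
    ((MulAut.conj s⁻¹).toMonoidHom.comp (P i).subtype).codRestrict ⊤ fun _ => Subgroup.mem_top _
  have hc : c ∈ F.Hom (P i) ⊤ := F.conj_mem c s fun u => by simp [c]
  refine F.mem_of_val_eq (F.comp_mem _ _ hk hc) fun u => ?_
  simp [c, k, mul_assoc]

/-- Conjugations in the multiple HNN extension between subgroups of `S` lie in every fusion system
that contains the `φ i`. The induction is on the distance between the vertices `S` and `g S` of the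
tree: the domain of the morphism fixes the geodesic between them. -/
theorem mem_of_conj (hτ : ∀ i k (u : P i), τ i (k * u) = τ i k * φ i u)
    {F : FusionSystem S} (hF : ∀ i, φ i ∈ F.Hom (P i) (Q i)) {A B : Subgroup S} (f : A →* B)
    (g : MultipleHNN P Q φ) (hf : ∀ u : A, of P Q φ (f u : S) = g⁻¹ * of P Q φ u * g) :
    f ∈ F.Hom A B := by
  classical
  set v := vertexMap hτ
  generalize hn : FreeGroup.norm (v.toFun g) = n
  induction n generalizing B g with
  | zero =>
    rw [FreeGroup.norm_eq_zero, ← vertexMap_one hτ] at hn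
    obtain ⟨s, hs⟩ := v.eq_iff.1 hn.symm
    rw [inv_one, one_mul] at hs
    refine F.conj_mem f s fun u => of_injective hτ ?_
    rw [hf, ← hs]
    simp
  | succ n ih =>
    obtain ⟨x, ⟨e, b⟩, hx, hxn⟩ := FreeGroup.exists_eq_mul_letter hn
    -- The penultimate vertex `g' S` of the geodesic from `S` to `g S`.
    obtain ⟨g', i, s, hg', hgg'⟩ : ∃ g' i s, v.toFun g' = x ∧
        (g = g' * stable P Q φ i * of P Q φ s ∨ g = g' * (stable P Q φ i)⁻¹ * of P Q φ s) := by
      obtain ⟨g₁, hg₁⟩ := v.surjective x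
      rw [← hg₁] at hx
      cases b
      · have h1 : v.toFun g₁ = v.toFun g * FreeGroup.of e := by
          rw [hx, FreeGroup.mk_singleton_false, inv_mul_cancel_right]
        obtain ⟨i, s, s', h2⟩ := exists_eq_of_coord_fst_eq hτ h1
        refine ⟨g₁ * of P Q φ s'⁻¹, i, s⁻¹, by rw [vertexMap_mul_of, hg₁], Or.inr ?_⟩
        rw [h2, map_inv, map_inv]
        group
      · obtain ⟨i, s, s', h2⟩ := exists_eq_of_coord_fst_eq hτ hx
        exact ⟨g₁ * of P Q φ s, i, s', by rw [vertexMap_mul_of, hg₁], Or.inl h2⟩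
    have hfix : ∀ u ∈ A, g'⁻¹ * of P Q φ u * g' ∈ (of P Q φ).range := by
      intro u hu
      rw [mul_assoc, ← v.eq_iff, eq_comm]
      refine v.mul_eq_of_mul_eq (vertexMap_one hτ) ⟨u, rfl⟩ (hg' ▸ hx) (by rw [hn, hg', hxn]) ?_
      rw [eq_comm, v.eq_iff, ← mul_assoc]
      exact ⟨_, hf ⟨u, hu⟩⟩
    obtain ⟨f', hf'⟩ := exists_hom_of_conj_mem_range (of_injective hτ) A hfix
    have hmem := ih f' g' hf' (by rw [hg', hxn])
    rcases hgg' with rfl | rfl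
    · exact mem_of_conj_mul_stable hτ hF hmem hf' hf
    · exact mem_of_conj_mul_stable_inv hτ hF hmem hf' hf

theorem ofGroup_eq_generatedBy (hτ : ∀ i k (u : P i), τ i (k * u) = τ i k * φ i u)
    (hφ : ∀ i, Function.Injective (φ i)) :
    FusionSystem.ofGroup (of P Q φ) (of_injective hτ) = FusionSystem.generatedBy P Q φ := by
  ext A B f
  constructor
  · rintro ⟨g, hg⟩
    exact mem_of_conj hτ (FusionSystem.generatedBy_isLeast P Q φ hφ).1 f g hg
  · intro hf
    exact hf.2 _ fun i => ⟨stable P Q φ i, fun u => (stable_conj P Q φ i u).symm⟩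

theorem isConjInto_of_finite (hτ : ∀ i k (u : P i), τ i (k * u) = τ i k * φ i u)
    (H : Subgroup (MultipleHNN P Q φ)) [Finite H] : H.IsConjInto (of P Q φ) := by
  obtain ⟨g, hg⟩ := (vertexMap hτ).exists_forall_conj_mem H
  refine ⟨g⁻¹, (H.map (MulAut.conj g⁻¹).toMonoidHom).comap (of P Q φ), ?_⟩
  rw [Subgroup.map_comap_eq_self]
  rintro _ ⟨h, hh, rfl⟩
  simpa using hg h hh

end MultipleHNN

theorem theorem1 {p : ℕ} (hp : p.Prime) {S : Type*} [Group S] [Finite S] (hS : IsPGroup p S)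
    {r : ℕ} (P Q : Fin r → Subgroup S) (φ : (i : Fin r) → P i →* Q i)
    (hφ : ∀ i, Function.Injective (φ i)) :
    ∃ hι : Function.Injective (MultipleHNN.of P Q φ),
      (∀ H : Subgroup (MultipleHNN P Q φ), Finite H → IsPGroup p H →
        H.IsConjInto (MultipleHNN.of P Q φ)) ∧
      FusionSystem.ofGroup (MultipleHNN.of P Q φ) hι = FusionSystem.generatedBy P Q φ ∧
      (∀ H : Subgroup (MultipleHNN P Q φ), Finite H → H.IsConjInto (MultipleHNN.of P Q φ)) ∧
      ∃ N : Subgroup (MultipleHNN P Q φ), N.Normal ∧ IsFreeGroup N ∧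
        N.index ∣ (Nat.card S).factorial := by
  choose τ hτ using fun i => Subgroup.exists_perm_intertwining (φ i) (hφ i)
  refine ⟨MultipleHNN.of_injective hτ, fun H _ _ => MultipleHNN.isConjInto_of_finite hτ H,
    MultipleHNN.ofGroup_eq_generatedBy hτ hφ, fun H _ => MultipleHNN.isConjInto_of_finite hτ H,
    (MultipleHNN.permRep τ hτ).ker, inferInstance, MultipleHNN.isFreeGroup_ker_permRep hτ, ?_⟩
  rw [Subgroup.index_ker, ← Nat.card_perm]
  exact Subgroup.card_subgroup_dvd_card _
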